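/- Work in $\mathbb{R}^2$ with Lebesgue measure and complex-valued functions. A dyadic grid is a collection $\mathcal{G}=\bigcup_{k\in\mathbb{Z}}\mathcal{G}_k$, where $\mathcal{G}_k$ consists of the half-open squares of side $2^{-k}$ whose lower left corners form a translate $b_k+2^{-k}\mathbb{Z}^2$ of the lattice, and $b_k-b_{k+1}\in 2^{-(k+1)}\mathbb{Z}^2$. Write $\ell(Q)$ for the side length of a square $Q$. Let $\kappa\in\mathbb{N}$ and $Q_0=[0,1)^2$. Let $\{h^a\}_{a\in\Gamma}$ be a finite orthonormal basis of the Alpert space of $Q_0$, i.e. of the space of functions that vanish off $Q_0$, agree on each of the four dyadic children of $Q_0$ with a polynomial of degree less than $\kappa$, and satisfy $\int_{Q_0} f(x)\,x^\beta dx=0$ for all $|\beta|<\kappa$. For a square $Q$ with lower left corner $c_Q$ put $h^a_{Q;\kappa}(x)=\ell(Q)^{-1}h^a\big((x-c_Q)/\ell(Q)\big)$. Let $\phi\in C_c^\infty(B(0,1))$ be real with $\int\phi=1$ and $\int\phi(x)x^\gamma dx=0$ for $0<|\gamma|<\kappa$, put $\phi_t(x)=t^{-2}\phi(x/t)$, let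 $\eta>0$, and let $h^{a,\eta}_{Q;\kappa}=h^a_{Q;\kappa}*\phi_{\eta\ell(Q)}$ be the smooth Alpert wavelets. Let $1<q\le p\le\infty$ with $q<\infty$. For a grid $\mathcal{G}$ let $$S^{\mathcal{G}}g=\sum_{I\in\mathcal{G}}\sum_{a\in\Gamma}\langle g,h^a_{I;\kappa}\rangle\,h^{a,\eta}_{I;\kappa},$$ with unconditional convergence in $L^q$, and let $(S^{\mathcal{G}})^{-1}f$ be the unique $g\in L^q$ (up to equality a.e.) with $S^{\mathcal{G}}g=f$; for small $\eta$ the operator $S^{\mathcal G}$ is bounded and invertible on $L^q$, and for general $\eta$ we put $(S^{\mathcal{G}})^{-1}f=0$ if there is no such unique $g$. For $I\in\mathcal{G}$, $s\in\mathbb{Z}$ and $U\subset\mathbb{R}^2$ define $$\triangle^{\eta,\mathcal{G}}_{I;\kappa}f=\sum_{a\in\Gamma}\big\langle (S^{\mathcal{G}})^{-1}f,h^a_{I;\kappa}\big\rangle\,h^{a,\eta}_{I;\kappa},\qquad \mathsf{Q}^{\eta,\mathcal{G}}_{\kappa,s,U}f=\sum_{I\in\mathcal{G},\ \ell(I)=2^{-s},\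 I\subset U}\triangle^{\eta,\mathcal{G}}_{I;\kappa}f,$$ $$\mathcal{F}_{\kappa,p}(s;U)=\big\{\mathsf{Q}^{\eta,\mathcal{G}}_{\kappa,s,U}f:\ \mathcal{G}\text{ a grid},\ \|f\|_{L^p(U)}\le1\big\},$$ where functions on $U$ are extended by zero, and let $\mathcal{F}_{\kappa,p}(s)$ be the union of the $\mathcal{F}_{\kappa,p}(s;U)$ over all bounded measurable $U\subset\mathbb{R}^2$. Fix $c\in\mathbb{R}^2$ and $m\in\mathbb{Z}$. Let $2^mE$ be the image of $E\subset\mathbb{R}^2$ under $x\mapsto c+2^m(x-c)$, let $2^m\mathcal{G}=\{2^mI:I\in\mathcal{G}\}$, and let $\delta_{m,p}f(x)=2^{-2m/p}f\big(c+2^{-m}(x-c)\big)$ be the $L^p$-preserving dilation about $c$. Let $U$ range over the measurable subsets of $\mathbb{R}^2$ that are bounded, or over all measurable subsets if $q=p$. Then: 1. For every grid $\mathcal{G}$, $2^m\mathcal{G}$ is a grid, and $$\delta_{m,p}\big(\triangle^{\eta,\mathcal{G}}_{I;\kappa}f\big)=\triangle^{\eta,2^m\mathcal{G}}_{2^mI;\kappa}(\delta_{m,p}f)\quad\text{for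 all }U,\ f\in L^p(U),\ I\in\mathcal{G}.$$ 2. $\delta_{m,p}\mathcal{F}_{\kappa,p}(s;U)=\mathcal{F}_{\kappa,p}(s-m;2^mU)$ for all $s\in\mathbb{Z}$ and all $U$; in particular, if $q=p<\infty$, the families with $U=\mathbb{R}^2$ satisfy $\delta_{m,p}\mathcal{F}_{\kappa,p}(s;\mathbb{R}^2)=\mathcal{F}_{\kappa,p}(s-m;\mathbb{R}^2)$. 3. $\delta_{m,p}\mathcal{F}_{\kappa,p}(s)=\mathcal{F}_{\kappa,p}(s-m)$ for all $s\in\mathbb{Z}$. -/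

import Mathlib

open MeasureTheory Filter Topology
open scoped ENNReal ContDiff

noncomputable section

namespace Alpert

/-- The Euclidean plane. -/
abbrev Plane : Type := EuclideanSpace ℝ (Fin 2)

/-- A half-open axis-parallel square of dyadic side length: it is determined by its lower left
corner and by its level `k`, the side length being `2 ^ (-k)`. -/
@[ext]
structure Square where
  corner : Plane
  level : ℤ

namespace Square

/-- The side length `ℓ(Q)`. -/
def side (Q : Square) : ℝ := (2 : ℝ) ^ (-Q.level)

/-- The set of points of the square. -/
def toSet (Q : Square) : Set Plane :=
  {x | ∀ i, Q.corner i ≤ x i ∧ x i < Q.corner i + Q.side}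

/-- The four dyadic children of a square, indexed by `{0, 1} × {0, 1}`. -/
def child (Q : Square) (ε : Fin 2 → Fin 2) : Square where
  corner := WithLp.toLp 2 fun i => Q.corner i + Q.side / 2 * ((ε i : ℕ) : ℝ)
  level := Q.level + 1

/-- The unit square `[0, 1) × [0, 1)`. -/
def unit : Square := ⟨0, 0⟩

end Square

/-- The dilation `x ↦ c + 2 ^ m (x - c)` of the plane about the point `c`. -/
def dilatePoint (c : Plane) (m : ℤ) (x : Plane) : Plane := c + (2 : ℝ) ^ m • (x - c)

/-- The dilated square `2 ^ m I` (dilation about the point `c`). -/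
def dilateSquare (c : Plane) (m : ℤ) (I : Square) : Square :=
  ⟨dilatePoint c m I.corner, I.level - m⟩

/-- The dilated collection `2 ^ m 𝒢 = {2 ^ m I : I ∈ 𝒢}`. -/
def dilateGrid (c : Plane) (m : ℤ) (𝒢 : Set Square) : Set Square := dilateSquare c m '' 𝒢

/-- The `L^p` preserving dilation `δ_{m,p} f (x) = 2 ^ (-2 m / p) f (c + 2 ^ (-m) (x - c))`
about the point `c`; for `p = ∞` the factor is `1`. -/
def dilateFun (c : Plane) (m : ℤ) (p : ℝ≥0∞) (f : Plane → ℂ) : Plane → ℂ := fun x =>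
  (((2 : ℝ) ^ (-2 * (m : ℝ) * (p⁻¹).toReal) : ℝ) : ℂ) * f (dilatePoint c (-m) x)

/-- A dyadic grid: for every `k ∈ ℤ` the squares of level `k` tile the plane as a translate
`b k + 2 ^ (-k) ℤ²` of the lattice, and the tilings are nested. This includes all translates of
the standard dyadic grid. -/
def IsGrid (𝒢 : Set Square) : Prop :=
  ∃ b : ℤ → Plane,
    (∀ k : ℤ, ∃ j : Fin 2 → ℤ, ∀ i, b k i = b (k + 1) i + (2 : ℝ) ^ (-(k + 1)) * (j i : ℝ)) ∧
    𝒢 = {Q | ∃ j : Fin 2 → ℤ, ∀ i, Q.corner i = b Q.level i + Q.side * (j i : ℝ)}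

/-- `𝒢_s[U]`: the squares of the grid of side length `2 ^ (-s)` that are contained in `U`. -/
def gridAt (𝒢 : Set Square) (s : ℤ) (U : Set Plane) : Set Square :=
  {I | I ∈ 𝒢 ∧ I.level = s ∧ I.toSet ⊆ U}

/-- The Alpert space `L²_{Q;κ}` (Lebesgue measure): functions which on each child of `Q` agree with
a polynomial of degree less than `κ`, vanish off `Q`, and are orthogonal on `Q` to all
polynomials of degree less than `κ`. -/
def alpertSpace (κ : ℕ) (Q : Square) : Set (Plane → ℝ) :=
  {f | (∃ P : (Fin 2 → Fin 2) → MvPolynomial (Fin 2) ℝ,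
      (∀ ε, ∀ α ∈ (P ε).support, α 0 + α 1 < κ) ∧
      f = fun x => ∑ ε, (Q.child ε).toSet.indicator
        (fun y => MvPolynomial.eval (fun i => y i) (P ε)) x) ∧
    ∀ a b : ℕ, a + b < κ → ∫ x in Q.toSet, f x * (x 0 ^ a * x 1 ^ b) = 0}

/-- `h` is an orthonormal basis of the Alpert space of the unit square, i.e. a family
`(h^a_{Q₀;κ})_{a ∈ Γ}` of unit Alpert wavelets. -/
structure IsUnitAlpertBasis {Γ : Type*} (κ : ℕ) (h : Γ → Plane → ℝ) : Prop where
  norm_one : ∀ a, ∫ x, h a x * h a x = 1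
  orthogonal : ∀ a b, a ≠ b → ∫ x, h a x * h b x = 0
  span_eq : (Submodule.span ℝ (Set.range h) : Set (Plane → ℝ)) = alpertSpace κ Square.unit

/-- The generator `φ` of the smooth approximate identity: `φ ∈ C_c^∞(B(0,1))`, with integral `1`
and vanishing moments of positive order less than `κ`. -/
structure IsMollifier (κ : ℕ) (φ : Plane → ℝ) : Prop where
  smooth : ContDiff ℝ ∞ φ
  compact : HasCompactSupport φ
  tsupport_subset : tsupport φ ⊆ Metric.ball 0 1
  integral_one : ∫ x, φ x = 1
  moments : ∀ a b : ℕ, 0 < a + b → a + b < κ → ∫ x, φ x * (x 0 ^ a * x 1 ^ b) = 0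

/-- `φ_t(x) = t^{-2} φ(x / t)`. -/
def approxId (φ : Plane → ℝ) (t : ℝ) (x : Plane) : ℝ := (t ^ 2)⁻¹ * φ (t⁻¹ • x)

section Wavelets

variable {Γ : Type*}

/-- The Alpert wavelet `h^a_{Q;κ}`: the `L²` normalized translate and dilate of the unit wavelet
`h^a_{Q₀;κ}` to the square `Q`. -/
def wavelet (h : Γ → Plane → ℝ) (Q : Square) (a : Γ) (x : Plane) : ℝ :=
  Q.side⁻¹ * h a (Q.side⁻¹ • (x - Q.corner))

/-- The smooth Alpert wavelet `h^{a,η}_{Q;κ} = h^a_{Q;κ} ∗ φ_{η ℓ(Q)}`. -/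
def smoothWavelet (φ : Plane → ℝ) (η : ℝ) (h : Γ → Plane → ℝ) (Q : Square) (a : Γ) :
    Plane → ℝ :=
  convolution (wavelet h Q a) (approxId φ (η * Q.side)) (ContinuousLinearMap.mul ℝ ℝ) volume

/-- The Alpert coefficient `⟨g, h^a_{Q;κ}⟩`. -/
def coeff (h : Γ → Plane → ℝ) (g : Plane → ℂ) (Q : Square) (a : Γ) : ℂ :=
  ∫ y, g y * (wavelet h Q a y : ℂ)

variable [Fintype Γ]

/-- `∑_a ⟨g, h^a_{Q;κ}⟩ h^{a,η}_{Q;κ} = (△_{Q;κ} g) ∗ φ_{η ℓ(Q)}`. -/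
def smoothTerm (φ : Plane → ℝ) (η : ℝ) (h : Γ → Plane → ℝ) (g : Plane → ℂ) (Q : Square) :
    Plane → ℂ := fun x =>
  ∑ a, coeff h g Q a * (smoothWavelet φ η h Q a x : ℂ)

/-- `f = S_{κ,η}^𝒢 g` in `L^q`. The operator `S = S_{κ,η}^𝒢` is the linear map with
`S h^a_{I;κ} = h^{a,η}_{I;κ}`, i.e. `S g = ∑_{I ∈ 𝒢} ∑_a ⟨g, h^a_{I;κ}⟩ h^{a,η}_{I;κ}`, with
unconditional convergence of the sum over the grid in `L^q`. -/
def IsImage (φ : Plane → ℝ) (η : ℝ) (h : Γ → Plane → ℝ) (q : ℝ≥0∞) (𝒢 : Set Square)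
    (g f : Plane → ℂ) : Prop :=
  Tendsto (fun F : Finset 𝒢 =>
    eLpNorm (fun x => f x - ∑ I ∈ F, smoothTerm φ η h g (I : Square) x) q volume) atTop (𝓝 0)

/-- `g` is the inverse image of `f` under `S_{κ,η}^𝒢` on `L^q`: the only element of `L^q`, up to
equality almost everywhere, that `S_{κ,η}^𝒢` maps to `f`. -/
def IsInverseImage (φ : Plane → ℝ) (η : ℝ) (h : Γ → Plane → ℝ) (q : ℝ≥0∞) (𝒢 : Set Square)
    (f g : Plane → ℂ) : Prop :=
  MemLp g q volume ∧ IsImage φ η h q 𝒢 g f ∧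
    ∀ g' : Plane → ℂ, MemLp g' q volume → IsImage φ η h q 𝒢 g' f → g' =ᵐ[volume] g

open Classical in
/-- `(S_{κ,η}^𝒢)⁻¹ f`, the inverse being taken on `L^q`. When `S_{κ,η}^𝒢` is bounded and invertible
on `L^q` (so for all small `η`), this is the usual inverse on all of `L^q`. The value is `0` where
the inverse is not defined. -/
def invS (φ : Plane → ℝ) (η : ℝ) (h : Γ → Plane → ℝ) (q : ℝ≥0∞) (𝒢 : Set Square)
    (f : Plane → ℂ) : Plane → ℂ :=
  if H : ∃ g, IsInverseImage φ η h q 𝒢 f g then H.choose else 0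

/-- The smooth Alpert pseudoprojection
`△^{η,𝒢}_{I;κ} f = ∑_a ⟨(S_{κ,η}^𝒢)⁻¹ f, h^a_{I;κ}⟩ h^{a,η}_{I;κ}`. -/
def pseudoproj (φ : Plane → ℝ) (η : ℝ) (h : Γ → Plane → ℝ) (q : ℝ≥0∞) (𝒢 : Set Square)
    (I : Square) (f : Plane → ℂ) : Plane → ℂ :=
  smoothTerm φ η h (invS φ η h q 𝒢 f) I

/-- The single scale pseudoprojection `Q^{η,𝒢}_{κ,s,U} f = ∑_{I ∈ 𝒢_s[U]} △^{η,𝒢}_{I;κ} f`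
(the sum has only finitely many nonzero terms at each point). -/
def scaleProj (φ : Plane → ℝ) (η : ℝ) (h : Γ → Plane → ℝ) (q : ℝ≥0∞) (𝒢 : Set Square)
    (s : ℤ) (U : Set Plane) (f : Plane → ℂ) : Plane → ℂ := fun x =>
  ∑' I : gridAt 𝒢 s U, pseudoproj φ η h q 𝒢 (I : Square) f x

/-- `𝓕_{κ,p}(s; U)`: all `Q^{η,𝒢}_{κ,s,U} f` with `𝒢` a grid and `f` in the unit ball of `L^p(U)`,
functions on `U` being extended by zero. -/
def localFamily (φ : Plane → ℝ) (η : ℝ) (h : Γ → Plane → ℝ) (q p : ℝ≥0∞)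
    (U : Set Plane) (s : ℤ) : Set (Plane → ℂ) :=
  {F | ∃ 𝒢 : Set Square, IsGrid 𝒢 ∧ ∃ f : Plane → ℂ, MemLp f p volume ∧
    Function.support f ⊆ U ∧ eLpNorm f p volume ≤ 1 ∧ F = scaleProj φ η h q 𝒢 s U f}

/-- `𝓕_{κ,p}(s)`: the union of the families `𝓕_{κ,p}(s; U)` over all bounded measurable sets
`U` of the plane. -/
def family (φ : Plane → ℝ) (η : ℝ) (h : Γ → Plane → ℝ) (q p : ℝ≥0∞) (s : ℤ) :
    Set (Plane → ℂ) :=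
  {F | ∃ U : Set Plane, MeasurableSet U ∧ Bornology.IsBounded U ∧
    F ∈ localFamily φ η h q p U s}

end Wavelets

end Alpert

end

namespace Alpert

/-! Everything is transported by the dilation. On `2 ^ m I` the wavelet and its mollification both
pick up the factor `2 ^ (-m)`, and the change of variables in a coefficient gives `2 ^ (2m)`. In
each term `⟨g, h⟩ h^η` these powers cancel, so the term map commutes with `dilateFun` for every `p`
(`smoothTerm_dilateFun`). Summing over the grid, dilation intertwines `S` on `𝒢` with `S` on `2 ^ m
𝒢`. Existence and uniqueness of preimages are preserved too, so the inverses are intertwined almost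
everywhere (`invS_dilateFun`). Coefficients see only a.e. classes, so the pseudoprojections match
pointwise. The exponent `p` matters only for preserving the unit ball (`eLpNorm_dilateFun_self`).
Equality of families follows from one inclusion, used for both `m` and `-m`. -/

/-! ### Dilations of the plane and Lebesgue measure. -/

lemma dilatePoint_apply (c : Plane) (m : ℤ) (x : Plane) (i : Fin 2) :
    dilatePoint c m x i = c i + (2 : ℝ) ^ m * (x i - c i) := by
  simp [dilatePoint]

@[simp]
lemma dilatePoint_neg_dilatePoint (c : Plane) (m : ℤ) (x : Plane) :
    dilatePoint c (-m) (dilatePoint c m x) = x := by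
  have hr : (2 : ℝ) ^ m ≠ 0 := by positivity
  simp [dilatePoint, smul_smul, inv_mul_cancel₀ hr]

@[simp]
lemma dilatePoint_dilatePoint_neg (c : Plane) (m : ℤ) (x : Plane) :
    dilatePoint c m (dilatePoint c (-m) x) = x := by
  simpa using dilatePoint_neg_dilatePoint c (-m) x

lemma continuous_dilatePoint (c : Plane) (m : ℤ) : Continuous (dilatePoint c m) := by
  unfold dilatePoint
  fun_prop

/-- The dilation about `c` as a homeomorphism of the plane. -/
noncomputable def dilateHomeomorph (c : Plane) (m : ℤ) : Plane ≃ₜ Plane where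
  toFun := dilatePoint c m
  invFun := dilatePoint c (-m)
  left_inv := dilatePoint_neg_dilatePoint c m
  right_inv := dilatePoint_dilatePoint_neg c m
  continuous_toFun := continuous_dilatePoint c m
  continuous_invFun := continuous_dilatePoint c (-m)

lemma measurableEmbedding_dilatePoint (c : Plane) (m : ℤ) :
    MeasurableEmbedding (dilatePoint c m) :=
  (dilateHomeomorph c m).measurableEmbedding

lemma image_dilatePoint (c : Plane) (m : ℤ) (U : Set Plane) :
    dilatePoint c m '' U = dilatePoint c (-m) ⁻¹' U :=
  (dilateHomeomorph c m).toEquiv.image_eq_preimage_symm U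

lemma image_dilatePoint_neg_image (c : Plane) (m : ℤ) (U : Set Plane) :
    dilatePoint c (-m) '' (dilatePoint c m '' U) = U := by
  simp [Set.image_image]

lemma measurableSet_image_dilatePoint (c : Plane) (m : ℤ) {U : Set Plane} (hU : MeasurableSet U) :
    MeasurableSet (dilatePoint c m '' U) :=
  (measurableEmbedding_dilatePoint c m).measurableSet_image.2 hU

lemma isBounded_image_dilatePoint (c : Plane) (m : ℤ) {U : Set Plane}
    (hU : Bornology.IsBounded U) : Bornology.IsBounded (dilatePoint c m '' U) :=
  ((hU.isCompact_closure.image (continuous_dilatePoint c m)).isBounded).subset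
    (Set.image_mono subset_closure)

lemma map_dilatePoint (c : Plane) (m : ℤ) :
    Measure.map (dilatePoint c m) volume =
      ENNReal.ofReal (((2 : ℝ) ^ m) ^ 2)⁻¹ • (volume : Measure Plane) := by
  ext s hs
  -- As an image under the inverse homothety, the preimage has its measure scaled by the square of
  -- the ratio, the plane being two-dimensional.
  have hd : dilatePoint c m ⁻¹' s = AffineMap.homothety c ((2 : ℝ) ^ (-m)) '' s := by
    rw [← neg_neg m, ← image_dilatePoint, neg_neg]
    refine Set.image_congr fun x _ => ?_
    simp [dilatePoint, AffineMap.homothety_apply, add_comm]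
  rw [Measure.map_apply (continuous_dilatePoint c m).measurable hs, hd,
    Measure.addHaar_image_homothety]
  simp

lemma integral_dilatePoint {E : Type*} [NormedAddCommGroup E] [NormedSpace ℝ E]
    (c : Plane) (m : ℤ) (F : Plane → E) :
    ∫ x, F x = ((2 : ℝ) ^ m) ^ 2 • ∫ x, F (dilatePoint c m x) := by
  rw [← (measurableEmbedding_dilatePoint c m).integral_map, map_dilatePoint,
    integral_smul_measure, ENNReal.toReal_ofReal (by positivity), smul_smul,
    mul_inv_cancel₀ (by positivity), one_smul]

/-! ### The dilation of functions and its effect on norms. -/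

/-- The scalar `2 ^ (-2 m / p)` in the definition of `dilateFun`. -/
noncomputable def dilateFactor (m : ℤ) (p : ℝ≥0∞) : ℂ :=
  (((2 : ℝ) ^ (-2 * (m : ℝ) * (p⁻¹).toReal) : ℝ) : ℂ)

lemma dilateFun_apply (c : Plane) (m : ℤ) (p : ℝ≥0∞) (f : Plane → ℂ) (x : Plane) :
    dilateFun c m p f x = dilateFactor m p * f (dilatePoint c (-m) x) := rfl

lemma dilateFun_eq_smul (c : Plane) (m : ℤ) (p : ℝ≥0∞) (f : Plane → ℂ) :
    dilateFun c m p f = dilateFactor m p • (f ∘ dilatePoint c (-m)) := rfl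

lemma dilateFactor_mul_neg (m : ℤ) (p : ℝ≥0∞) : dilateFactor m p * dilateFactor (-m) p = 1 := by
  rw [dilateFactor, dilateFactor, ← Complex.ofReal_mul, ← Real.rpow_add two_pos]
  simp

@[simp]
lemma dilateFun_dilateFun_neg (c : Plane) (m : ℤ) (p : ℝ≥0∞) (f : Plane → ℂ) :
    dilateFun c m p (dilateFun c (-m) p f) = f := by
  funext x
  simp [dilateFun_apply, ← mul_assoc, dilateFactor_mul_neg]

@[simp]
lemma dilateFun_neg_dilateFun (c : Plane) (m : ℤ) (p : ℝ≥0∞) (f : Plane → ℂ) :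
    dilateFun c (-m) p (dilateFun c m p f) = f := by
  simpa using dilateFun_dilateFun_neg c (-m) p f

@[simp]
lemma dilateFun_zero (c : Plane) (m : ℤ) (p : ℝ≥0∞) : dilateFun c m p 0 = 0 := by
  funext x
  simp [dilateFun_apply]

/-- The exponents are kept separate because the dilation is normalized in `L^p` while `S` converges
in `L^q`. At `q = ∞` the Jacobian enters with exponent `0`. -/
lemma eLpNorm_dilateFun (c : Plane) (m : ℤ) (p q : ℝ≥0∞) (f : Plane → ℂ) :
    eLpNorm (dilateFun c m p f) q volume =
      ‖dilateFactor m p‖ₑ * (ENNReal.ofReal (((2 : ℝ) ^ (-m)) ^ 2)⁻¹ ^ (1 / q).toReal *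
        eLpNorm f q volume) := by
  rw [dilateFun_eq_smul, eLpNorm_const_smul,
    ← (measurableEmbedding_dilatePoint c (-m)).eLpNorm_map_measure, map_dilatePoint,
    eLpNorm_smul_measure_of_ne_zero, smul_eq_mul]
  rw [ne_eq, ENNReal.ofReal_eq_zero, not_le]
  positivity

lemma eLpNorm_dilateFun_self (c : Plane) (m : ℤ) (p : ℝ≥0∞) (f : Plane → ℂ) :
    eLpNorm (dilateFun c m p f) p volume = eLpNorm f p volume := by
  have hfac : ‖dilateFactor m p‖ₑ * ENNReal.ofReal (((2 : ℝ) ^ (-m)) ^ 2)⁻¹ ^ (1 / p).toReal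
      = 1 := by
    have h2 : (((2 : ℝ) ^ (-m)) ^ 2)⁻¹ = (2 : ℝ) ^ (2 * (m : ℝ)) := by
      rw [mul_comm, Real.rpow_mul two_pos.le, Real.rpow_intCast]
      simp
    rw [h2, dilateFactor, ENNReal.ofReal_rpow_of_pos (by positivity), ← Real.rpow_mul two_pos.le,
      ← ofReal_norm, Complex.norm_real, Real.norm_of_nonneg (by positivity),
      ← ENNReal.ofReal_mul (by positivity), ← Real.rpow_add two_pos]
    simp
  rw [eLpNorm_dilateFun, ← mul_assoc, hfac, one_mul]

lemma memLp_dilateFun (c : Plane) (m : ℤ) (p : ℝ≥0∞) {q : ℝ≥0∞} {f : Plane → ℂ}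
    (hf : MemLp f q volume) : MemLp (dilateFun c m p f) q volume := by
  rw [dilateFun_eq_smul]
  refine MemLp.const_smul ?_ _
  rw [← (measurableEmbedding_dilatePoint c (-m)).memLp_map_measure_iff, map_dilatePoint]
  exact hf.smul_measure ENNReal.ofReal_ne_top

lemma dilateFun_ae_congr (c : Plane) (m : ℤ) (p : ℝ≥0∞) {f g : Plane → ℂ}
    (hfg : f =ᵐ[volume] g) : dilateFun c m p f =ᵐ[volume] dilateFun c m p g := by
  have hmap : ∀ᵐ y ∂(Measure.map (dilatePoint c (-m)) volume), f y = g y := by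
    rw [map_dilatePoint]
    exact Measure.ae_smul_measure hfg _
  filter_upwards [(measurableEmbedding_dilatePoint c (-m)).ae_map_iff.1 hmap] with x hx
  simp [dilateFun_apply, hx]

lemma support_dilateFun (c : Plane) (m : ℤ) (p : ℝ≥0∞) {f : Plane → ℂ} {U : Set Plane}
    (hf : Function.support f ⊆ U) :
    Function.support (dilateFun c m p f) ⊆ dilatePoint c m '' U := by
  rw [image_dilatePoint]
  intro x hx
  exact hf (right_ne_zero_of_mul hx)

/-! ### Dilation of squares and grids. -/

@[simp]
lemma dilateSquare_neg_dilateSquare (c : Plane) (m : ℤ) (I : Square) :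
    dilateSquare c (-m) (dilateSquare c m I) = I := by
  ext <;> simp [dilateSquare]

@[simp]
lemma dilateSquare_dilateSquare_neg (c : Plane) (m : ℤ) (I : Square) :
    dilateSquare c m (dilateSquare c (-m) I) = I := by
  simpa using dilateSquare_neg_dilateSquare c (-m) I

/-- The dilation about `c` as a permutation of the squares. -/
noncomputable def dilateSquareEquiv (c : Plane) (m : ℤ) : Square ≃ Square where
  toFun := dilateSquare c m
  invFun := dilateSquare c (-m)
  left_inv := dilateSquare_neg_dilateSquare c m
  right_inv := dilateSquare_dilateSquare_neg c m

lemma mem_dilateGrid (c : Plane) (m : ℤ) (𝒢 : Set Square) (I : Square) :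
    I ∈ dilateGrid c m 𝒢 ↔ dilateSquare c (-m) I ∈ 𝒢 :=
  Set.ext_iff.1 ((dilateSquareEquiv c m).image_eq_preimage_symm 𝒢) I

lemma dilateGrid_neg_dilateGrid (c : Plane) (m : ℤ) (𝒢 : Set Square) :
    dilateGrid c (-m) (dilateGrid c m 𝒢) = 𝒢 := by
  simp [dilateGrid, Set.image_image]

lemma side_dilateSquare (c : Plane) (m : ℤ) (I : Square) :
    (dilateSquare c m I).side = (2 : ℝ) ^ m * I.side := by
  rw [Square.side, Square.side, ← zpow_add₀ two_ne_zero]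
  congr 1
  simp only [dilateSquare]
  ring

lemma dilatePoint_mem_toSet (c : Plane) (m : ℤ) (I : Square) (x : Plane) :
    dilatePoint c m x ∈ (dilateSquare c m I).toSet ↔ x ∈ I.toSet := by
  have hr : (0 : ℝ) < 2 ^ m := by positivity
  simp only [Square.toSet, Set.mem_ofPred_eq, side_dilateSquare]
  refine forall_congr' fun i => ?_
  simp only [dilateSquare, dilatePoint_apply]
  refine and_congr ?_ ?_
  · rw [add_le_add_iff_left, mul_le_mul_iff_right₀ hr, sub_le_sub_iff_right]
  · rw [add_assoc, ← mul_add, add_lt_add_iff_left, mul_lt_mul_iff_right₀ hr, sub_add_eq_add_sub,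
      sub_lt_sub_iff_right]

lemma toSet_dilateSquare (c : Plane) (m : ℤ) (I : Square) :
    (dilateSquare c m I).toSet = dilatePoint c m '' I.toSet := by
  ext x
  rw [image_dilatePoint, Set.mem_preimage, ← dilatePoint_mem_toSet c m I,
    dilatePoint_dilatePoint_neg]

lemma isGrid_dilateGrid (c : Plane) (m : ℤ) {𝒢 : Set Square} (h𝒢 : IsGrid 𝒢) :
    IsGrid (dilateGrid c m 𝒢) := by
  obtain ⟨b, hb, rfl⟩ := h𝒢
  have hr : (2 : ℝ) ^ m ≠ 0 := by positivity
  -- Dilation lowers levels by `m`, so level `k` of the new grid comes from level `k + m` of the old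
  -- one.
  refine ⟨fun k => dilatePoint c m (b (k + m)), fun k => ?_, ?_⟩
  · obtain ⟨j, hj⟩ := hb (k + m)
    refine ⟨j, fun i => ?_⟩
    have hexp : (2 : ℝ) ^ (-(k + 1)) = 2 ^ m * 2 ^ (-(k + m + 1)) := by
      rw [← zpow_add₀ two_ne_zero]
      congr 1
      ring
    rw [dilatePoint_apply, dilatePoint_apply, hj i, hexp, show k + 1 + m = k + m + 1 by ring]
    ring
  · ext Q
    rw [mem_dilateGrid]
    refine exists_congr fun j => forall_congr' fun i => ?_
    rw [side_dilateSquare]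
    simp only [dilateSquare, dilatePoint_apply, zpow_neg, sub_neg_eq_add]
    rw [← mul_right_inj' hr (b := c i + _), ← sub_eq_zero, ← sub_eq_zero (a := Q.corner i)]
    refine Eq.congr_left ?_
    field_simp
    ring

lemma gridAt_dilateGrid (c : Plane) (m s : ℤ) (𝒢 : Set Square) (U : Set Plane) :
    gridAt (dilateGrid c m 𝒢) (s - m) (dilatePoint c m '' U) = dilateSquare c m '' gridAt 𝒢 s U := by
  rw [show dilateSquare c m '' gridAt 𝒢 s U = dilateSquare c (-m) ⁻¹' gridAt 𝒢 s U from
    (dilateSquareEquiv c m).image_eq_preimage_symm _]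
  ext I
  simp only [gridAt, Set.mem_ofPred_eq, Set.mem_preimage, mem_dilateGrid, toSet_dilateSquare]
  refine and_congr Iff.rfl (and_congr ?_ ?_)
  · simp only [dilateSquare]
    omega
  · rw [image_dilatePoint, Set.image_subset_iff]

/-! ### Scaling of wavelets, coefficients and the terms of `S`. -/

section Wavelets

variable {Γ : Type*}

lemma wavelet_dilateSquare (h : Γ → Plane → ℝ) (c : Plane) (m : ℤ) (I : Square) (a : Γ)
    (x : Plane) :
    wavelet h (dilateSquare c m I) a (dilatePoint c m x) = ((2 : ℝ) ^ m)⁻¹ * wavelet h I a x := by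
  have hr : (2 : ℝ) ^ m ≠ 0 := by positivity
  have harg : (dilateSquare c m I).side⁻¹ • (dilatePoint c m x - (dilateSquare c m I).corner) =
      I.side⁻¹ • (x - I.corner) := by
    rw [side_dilateSquare]
    simp only [dilateSquare, dilatePoint]
    rw [add_sub_add_left_eq_sub, ← smul_sub, smul_smul, sub_sub_sub_cancel_right]
    congr 1
    field_simp
  rw [wavelet, wavelet, harg, side_dilateSquare, mul_inv, mul_assoc]

/-- The Jacobian `2 ^ (2m)` cancels the normalization of `φ_t` at the dilated scale, leaving only
the factor of the wavelet. -/
lemma smoothWavelet_dilateSquare (φ : Plane → ℝ) (η : ℝ) (h : Γ → Plane → ℝ) (c : Plane) (m : ℤ)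
    (I : Square) (a : Γ) (x : Plane) :
    smoothWavelet φ η h (dilateSquare c m I) a (dilatePoint c m x) =
      ((2 : ℝ) ^ m)⁻¹ * smoothWavelet φ η h I a x := by
  have hr : (2 : ℝ) ^ m ≠ 0 := by positivity
  rw [smoothWavelet, smoothWavelet, convolution_def, convolution_def, integral_dilatePoint c m,
    smul_eq_mul, ← integral_const_mul, ← integral_const_mul]
  refine integral_congr_ae (.of_forall fun t => ?_)
  have harg : (η * (dilateSquare c m I).side)⁻¹ • (dilatePoint c m x - dilatePoint c m t) =
      (η * I.side)⁻¹ • (x - t) := by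
    rw [side_dilateSquare]
    simp only [dilatePoint]
    rw [add_sub_add_left_eq_sub, ← smul_sub, smul_smul, sub_sub_sub_cancel_right]
    congr 1
    simp only [mul_inv]
    field_simp
  simp only [ContinuousLinearMap.mul_apply', approxId]
  rw [harg, wavelet_dilateSquare, side_dilateSquare]
  simp only [mul_pow, mul_inv]
  field_simp

lemma coeff_dilateFun (h : Γ → Plane → ℝ) (c : Plane) (m : ℤ) (p : ℝ≥0∞) (g : Plane → ℂ)
    (I : Square) (a : Γ) :
    coeff h (dilateFun c m p g) (dilateSquare c m I) a =
      dilateFactor m p * (((2 : ℝ) ^ m : ℝ) : ℂ) * coeff h g I a := by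
  have hr : (((2 : ℝ) ^ m : ℝ) : ℂ) ≠ 0 := Complex.ofReal_ne_zero.2 (by positivity)
  rw [coeff, coeff, integral_dilatePoint c m, Complex.real_smul, ← integral_const_mul,
    ← integral_const_mul]
  refine integral_congr_ae (.of_forall fun y => ?_)
  simp only [dilateFun_apply, dilatePoint_neg_dilatePoint, wavelet_dilateSquare,
    Complex.ofReal_mul, Complex.ofReal_inv, Complex.ofReal_pow]
  field_simp

lemma coeff_congr_ae (h : Γ → Plane → ℝ) {g g' : Plane → ℂ} (hg : g =ᵐ[volume] g') (I : Square)
    (a : Γ) : coeff h g I a = coeff h g' I a := by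
  refine integral_congr_ae ?_
  filter_upwards [hg] with y hy
  rw [hy]

variable [Fintype Γ]

lemma smoothTerm_congr_ae (φ : Plane → ℝ) (η : ℝ) (h : Γ → Plane → ℝ) {g g' : Plane → ℂ}
    (hg : g =ᵐ[volume] g') (I : Square) : smoothTerm φ η h g I = smoothTerm φ η h g' I := by
  funext x
  simp only [smoothTerm, coeff_congr_ae h hg]

lemma smoothTerm_dilateFun (φ : Plane → ℝ) (η : ℝ) (h : Γ → Plane → ℝ) (c : Plane) (m : ℤ)
    (p : ℝ≥0∞) (g : Plane → ℂ) (I : Square) :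
    smoothTerm φ η h (dilateFun c m p g) (dilateSquare c m I) =
      dilateFun c m p (smoothTerm φ η h g I) := by
  have hr : (((2 : ℝ) ^ m : ℝ) : ℂ) ≠ 0 := Complex.ofReal_ne_zero.2 (by positivity)
  funext x
  obtain ⟨y, rfl⟩ : ∃ y, x = dilatePoint c m y := ⟨_, (dilatePoint_dilatePoint_neg c m x).symm⟩
  simp only [dilateFun_apply, smoothTerm, dilatePoint_neg_dilatePoint, coeff_dilateFun,
    smoothWavelet_dilateSquare, Finset.mul_sum, Complex.ofReal_mul, Complex.ofReal_inv]
  refine Finset.sum_congr rfl fun a _ => ?_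
  field_simp

/-! ### Covariance of `S` and of its inverse. -/

lemma IsImage.dilate {φ : Plane → ℝ} {η : ℝ} {h : Γ → Plane → ℝ} {q : ℝ≥0∞} {𝒢 : Set Square}
    {g f : Plane → ℂ} (hgf : IsImage φ η h q 𝒢 g f) (c : Plane) (m : ℤ) (p : ℝ≥0∞) :
    IsImage φ η h q (dilateGrid c m 𝒢) (dilateFun c m p g) (dilateFun c m p f) := by
  let e : 𝒢 ≃ dilateGrid c m 𝒢 := (dilateSquareEquiv c m).image 𝒢
  have hterm : ∀ F : Finset 𝒢, (fun x => dilateFun c m p f x -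
      ∑ I ∈ e.finsetCongr F, smoothTerm φ η h (dilateFun c m p g) (I : Square) x) =
      dilateFun c m p (fun x => f x - ∑ I ∈ F, smoothTerm φ η h g (I : Square) x) := by
    intro F
    funext x
    have he : ∀ I : 𝒢, (e I : Square) = dilateSquare c m I := fun _ => rfl
    simp only [Equiv.finsetCongr_apply, Finset.sum_map, Equiv.coe_toEmbedding, he,
      smoothTerm_dilateFun, dilateFun_apply, mul_sub, Finset.mul_sum]
  have hmap : Tendsto (fun F : Finset 𝒢 => eLpNorm (fun x => dilateFun c m p f x -
      ∑ I ∈ e.finsetCongr F, smoothTerm φ η h (dilateFun c m p g) (I : Square) x) q volume)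
      atTop (𝓝 0) := by
    simp only [hterm, eLpNorm_dilateFun, ← mul_assoc]
    have := ENNReal.Tendsto.const_mul (a := ‖dilateFactor m p‖ₑ *
      ENNReal.ofReal (((2 : ℝ) ^ (-m)) ^ 2)⁻¹ ^ (1 / q).toReal) hgf (Or.inr ?_)
    · simpa using this
    · exact ENNReal.mul_ne_top enorm_ne_top
        (ENNReal.rpow_ne_top_of_nonneg ENNReal.toReal_nonneg ENNReal.ofReal_ne_top)
  -- Pulling finite subfamilies back along the bijection of grids is cofinal, so the limit over `𝒢`
  -- becomes a limit over `2 ^ m 𝒢`.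
  have hcomp := hmap.comp (Monotone.tendsto_atTop_atTop (f := e.symm.finsetCongr)
    (fun _ _ hs => Finset.map_subset_map.2 hs)
    fun F => ⟨e.finsetCongr F, by simp [Finset.map_map]⟩)
  simpa [IsImage, Function.comp_def] using hcomp

lemma IsInverseImage.dilate {φ : Plane → ℝ} {η : ℝ} {h : Γ → Plane → ℝ} {q : ℝ≥0∞}
    {𝒢 : Set Square} {f g : Plane → ℂ} (hfg : IsInverseImage φ η h q 𝒢 f g) (c : Plane) (m : ℤ)
    (p : ℝ≥0∞) :
    IsInverseImage φ η h q (dilateGrid c m 𝒢) (dilateFun c m p f) (dilateFun c m p g) := by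
  obtain ⟨hg, himg, huniq⟩ := hfg
  refine ⟨memLp_dilateFun c m p hg, himg.dilate c m p, fun g' hg' himg' => ?_⟩
  -- A competing preimage is dilated back to `𝒢`, where uniqueness applies.
  have hback := himg'.dilate c (-m) p
  rw [dilateGrid_neg_dilateGrid, dilateFun_neg_dilateFun] at hback
  simpa using dilateFun_ae_congr c m p (huniq _ (memLp_dilateFun c (-m) p hg') hback)

lemma isInverseImage_invS {φ : Plane → ℝ} {η : ℝ} {h : Γ → Plane → ℝ} {q : ℝ≥0∞}
    {𝒢 : Set Square} {f : Plane → ℂ} (H : ∃ g, IsInverseImage φ η h q 𝒢 f g) :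
    IsInverseImage φ η h q 𝒢 f (invS φ η h q 𝒢 f) := by
  rw [invS, dif_pos H]
  exact H.choose_spec

/-- Only an a.e. identity is possible, since `invS` chooses a representative. Without an inverse on
`𝒢` there is none on `2 ^ m 𝒢` either, so the default value `0` occurs on both sides. -/
lemma invS_dilateFun (φ : Plane → ℝ) (η : ℝ) (h : Γ → Plane → ℝ) (q : ℝ≥0∞) (𝒢 : Set Square)
    (c : Plane) (m : ℤ) (p : ℝ≥0∞) (f : Plane → ℂ) :
    invS φ η h q (dilateGrid c m 𝒢) (dilateFun c m p f) =ᵐ[volume]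
      dilateFun c m p (invS φ η h q 𝒢 f) := by
  by_cases H : ∃ g, IsInverseImage φ η h q 𝒢 f g
  · have hg := (isInverseImage_invS H).dilate c m p
    have hg' := isInverseImage_invS ⟨_, hg⟩
    exact hg.2.2 _ hg'.1 hg'.2.1
  · have H' : ¬∃ g, IsInverseImage φ η h q (dilateGrid c m 𝒢) (dilateFun c m p f) g := by
      rintro ⟨g, hg⟩
      have hback := hg.dilate c (-m) p
      rw [dilateGrid_neg_dilateGrid, dilateFun_neg_dilateFun] at hback
      exact H ⟨_, hback⟩
    rw [invS, invS, dif_neg H, dif_neg H', dilateFun_zero]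

/-! ### Pseudoprojections and their families. -/

lemma dilateFun_pseudoproj (φ : Plane → ℝ) (η : ℝ) (h : Γ → Plane → ℝ) (q : ℝ≥0∞)
    (𝒢 : Set Square) (c : Plane) (m : ℤ) (p : ℝ≥0∞) (I : Square) (f : Plane → ℂ) :
    dilateFun c m p (pseudoproj φ η h q 𝒢 I f) =
      pseudoproj φ η h q (dilateGrid c m 𝒢) (dilateSquare c m I) (dilateFun c m p f) := by
  rw [pseudoproj, pseudoproj, smoothTerm_congr_ae φ η h (invS_dilateFun φ η h q 𝒢 c m p f),
    smoothTerm_dilateFun]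

lemma dilateFun_scaleProj (φ : Plane → ℝ) (η : ℝ) (h : Γ → Plane → ℝ) (q : ℝ≥0∞)
    (𝒢 : Set Square) (c : Plane) (m : ℤ) (p : ℝ≥0∞) (s : ℤ) (U : Set Plane) (f : Plane → ℂ) :
    dilateFun c m p (scaleProj φ η h q 𝒢 s U f) =
      scaleProj φ η h q (dilateGrid c m 𝒢) (s - m) (dilatePoint c m '' U)
        (dilateFun c m p f) := by
  funext x
  rw [dilateFun_apply, scaleProj, scaleProj, gridAt_dilateGrid, ← tsum_mul_left]
  -- Reindexing by a bijection needs no summability.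
  refine Eq.trans (tsum_congr fun I => ?_)
    (((dilateSquareEquiv c m).image (gridAt 𝒢 s U)).tsum_eq fun I =>
      pseudoproj φ η h q (dilateGrid c m 𝒢) (I : Square) (dilateFun c m p f) x)
  rw [← dilateFun_apply, dilateFun_pseudoproj]
  rfl

lemma dilateFun_mem_localFamily {φ : Plane → ℝ} {η : ℝ} {h : Γ → Plane → ℝ} {q p : ℝ≥0∞}
    {U : Set Plane} {s : ℤ} {F : Plane → ℂ} (hF : F ∈ localFamily φ η h q p U s) (c : Plane)
    (m : ℤ) :
    dilateFun c m p F ∈ localFamily φ η h q p (dilatePoint c m '' U) (s - m) := by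
  obtain ⟨𝒢, h𝒢, f, hf, hfU, hf1, rfl⟩ := hF
  exact ⟨dilateGrid c m 𝒢, isGrid_dilateGrid c m h𝒢, dilateFun c m p f, memLp_dilateFun c m p hf,
    support_dilateFun c m p hfU, (eLpNorm_dilateFun_self c m p f).trans_le hf1,
    dilateFun_scaleProj φ η h q 𝒢 c m p s U f⟩

lemma image_dilateFun_localFamily (φ : Plane → ℝ) (η : ℝ) (h : Γ → Plane → ℝ) (q p : ℝ≥0∞)
    (U : Set Plane) (s : ℤ) (c : Plane) (m : ℤ) :
    dilateFun c m p '' localFamily φ η h q p U s =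
      localFamily φ η h q p (dilatePoint c m '' U) (s - m) := by
  refine Set.Subset.antisymm ?_ fun F hF => ?_
  · rintro _ ⟨F, hF, rfl⟩
    exact dilateFun_mem_localFamily hF c m
  · refine ⟨dilateFun c (-m) p F, ?_, dilateFun_dilateFun_neg c m p F⟩
    simpa [image_dilatePoint_neg_image] using dilateFun_mem_localFamily hF c (-m)

lemma dilateFun_mem_family {φ : Plane → ℝ} {η : ℝ} {h : Γ → Plane → ℝ} {q p : ℝ≥0∞}
    {s : ℤ} {F : Plane → ℂ} (hF : F ∈ family φ η h q p s) (c : Plane) (m : ℤ) :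
    dilateFun c m p F ∈ family φ η h q p (s - m) := by
  obtain ⟨U, hU, hUb, hF⟩ := hF
  exact ⟨_, measurableSet_image_dilatePoint c m hU, isBounded_image_dilatePoint c m hUb,
    dilateFun_mem_localFamily hF c m⟩

lemma image_dilateFun_family (φ : Plane → ℝ) (η : ℝ) (h : Γ → Plane → ℝ) (q p : ℝ≥0∞)
    (s : ℤ) (c : Plane) (m : ℤ) :
    dilateFun c m p '' family φ η h q p s = family φ η h q p (s - m) := by
  refine Set.Subset.antisymm ?_ fun F hF => ?_
  · rintro _ ⟨F, hF, rfl⟩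
    exact dilateFun_mem_family hF c m
  · refine ⟨dilateFun c (-m) p F, ?_, dilateFun_dilateFun_neg c m p F⟩
    simpa using dilateFun_mem_family hF c (-m)

end Wavelets

end Alpert

/-- Dilation covariance of smooth Alpert pseudoprojections and dilation invariance of the families
of single scale pseudoprojections. -/
theorem mainTheorem4 {Γ : Type*} [Fintype Γ] (κ : ℕ) (h : Γ → Alpert.Plane → ℝ)
    (hh : Alpert.IsUnitAlpertBasis κ h) (φ : Alpert.Plane → ℝ) (hφ : Alpert.IsMollifier κ φ)
    (η : ℝ) (hη : 0 < η) (q p : ℝ≥0∞) (hq : 1 < q) (hq' : q ≠ ⊤) (hqp : q ≤ p)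
    (c : Alpert.Plane) (m : ℤ) :
    (∀ 𝒢 : Set Alpert.Square, Alpert.IsGrid 𝒢 →
      Alpert.IsGrid (Alpert.dilateGrid c m 𝒢) ∧
      ∀ (U : Set Alpert.Plane), MeasurableSet U → (Bornology.IsBounded U ∨ q = p) →
      ∀ (f : Alpert.Plane → ℂ), MemLp f p volume → Function.support f ⊆ U →
      ∀ I ∈ 𝒢,
        Alpert.dilateFun c m p (Alpert.pseudoproj φ η h q 𝒢 I f) =
          Alpert.pseudoproj φ η h q (Alpert.dilateGrid c m 𝒢) (Alpert.dilateSquare c m I)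
            (Alpert.dilateFun c m p f)) ∧
    (∀ (U : Set Alpert.Plane), MeasurableSet U → (Bornology.IsBounded U ∨ q = p) → ∀ s : ℤ,
      Alpert.dilateFun c m p '' Alpert.localFamily φ η h q p U s =
        Alpert.localFamily φ η h q p (Alpert.dilatePoint c m '' U) (s - m)) ∧
    (∀ s : ℤ, Alpert.dilateFun c m p '' Alpert.family φ η h q p s =
      Alpert.family φ η h q p (s - m)) := by
  refine ⟨fun 𝒢 h𝒢 => ⟨Alpert.isGrid_dilateGrid c m h𝒢, fun _ _ _ f _ _ I _ => ?_⟩,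
    fun U _ _ s => ?_, fun s => ?_⟩
  · exact Alpert.dilateFun_pseudoproj φ η h q 𝒢 c m p I f
  · exact Alpert.image_dilateFun_localFamily φ η h q p U s c m
  · exact Alpert.image_dilateFun_family φ η h q p s c m
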